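/- A player with budget $B$ takes part in $T$ sequential first-price auctions, where $T\ge 1$ is an integer and $0<B\le T$. In each round $t=1,\dots,T$ the player picks a shading multiplier $\lambda_t\in[0,1]$, and an adversary picks the player's value $v_t\in[0,1]$, the highest competing bid $d_t\ge 0$, and how a tie would be broken. The player's bid is $b_t=\min\{\lambda_t v_t,B_t\}$, where $B_t$ is her remaining budget ($B_1=B$). She wins the item if $b_t>d_t$, or if $b_t=d_t$ and the tie is broken in her favour. If she wins, she pays $b_t$ (so $B_{t+1}=B_t-b_t$) and gains utility $v_t-b_t$; otherwise she pays and gains nothing. Let $U$ be her total utility over the $T$ rounds. For $\lambda\in[0,1]$ let $\hat U(\lambda)$ be the total utility that she would have obtained with the multiplier $\lambda$ in every round, with the same values, competing bids and tie-breaking as were realized. A (randomized) algorithm chooses the distribution of $\lambda_t$ as a function of $\lambda_s,v_s,d_s$ for $s<t$; in particular it uses that $d_s$ is revealed after round $s$. An adaptive (possibly randomized) adversary chooses the distribution of its round-$t$ move as a function of everything that happened in the rounds $s<t$, including the multipliers the player used; given these rounds, its move is independent of $\lambda_t$. Theorem. There is an absolute constant $C>0$ such that for all integers $T\ge1$ and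 all real $B$ with $0<B\le T$ there is an algorithm with the following property: against every adaptive adversary and for every $\delta>0$, $$\Pr\left[\,U\;\ge\;\frac{\sup_{\lambda\in[0,1]}\hat U(\lambda)-C\,\frac{T^{3/2}}{B}\sqrt{\log(T/\delta)}}{T/B}\,\right]\;\ge\;1-\delta .$$ (For $\delta> T$ the square root is read as $0$; for $\delta\ge 1$ the claim is void.) -/

import Mathlib

open MeasureTheory ProbabilityTheory
open scoped unitInterval NNReal ENNReal

namespace FirstPrice

/-- What the adversary picks in a round: the player's value `v ∈ [0, 1]` for the item, the highest
competing bid `d ≥ 0`, and whether the player wins a tie at `d`. -/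
abbrev Move : Type := I × ℝ≥0 × Bool

/-- A round: the shading multiplier used by the player, and the adversary's move. -/
abbrev Round : Type := I × Move

/-- What the player knows about a past round: her multiplier, her value, and the highest
competing bid. -/
abbrev Observation : Type := I × I × ℝ≥0

namespace Round

/-- The player's multiplier. -/
def mult (r : Round) : ℝ := r.1

/-- The player's value for the item. -/
def value (r : Round) : ℝ := r.2.1

/-- The highest competing bid. -/
def competing (r : Round) : ℝ := r.2.2.1

/-- Whether a tie is broken in favour of the player. -/
def winsTie (r : Round) : Prop := r.2.2.2 = true

/-- The part of a round that is revealed to the player. -/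
def observe (r : Round) : Observation := (r.1, r.2.1, r.2.2.1)

/-- The bid submitted when the remaining budget is `b`: the shaded value, lowered to the remaining
budget if it exceeds it. -/
noncomputable def bid (b : ℝ) (r : Round) : ℝ := min (r.mult * r.value) b

/-- The player wins the item of round `r` when her remaining budget is `b`. -/
def Wins (b : ℝ) (r : Round) : Prop :=
  r.competing < r.bid b ∨ (r.competing = r.bid b ∧ r.winsTie)

end Round

open Classical in
/-- The budget that remains after the rounds of `h`, starting from the budget `B`: the winner of an
item pays her bid. -/
noncomputable def remaining (B : ℝ) : (t : ℕ) → (Fin t → Round) → ℝ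
  | 0, _ => B
  | t + 1, h =>
    let b := remaining B t (Fin.init h)
    let r := h (Fin.last t)
    if r.Wins b then b - r.bid b else b

open Classical in
/-- The total utility (value minus payment over the items won) from the rounds of `h`, starting
from the budget `B`. -/
noncomputable def utility (B : ℝ) : (t : ℕ) → (Fin t → Round) → ℝ
  | 0, _ => 0
  | t + 1, h =>
    let b := remaining B t (Fin.init h)
    let r := h (Fin.last t)
    utility B t (Fin.init h) + if r.Wins b then r.value - r.bid b else 0

/-- The utility that the player would have had with the fixed multiplier `l` in every round,
against the adversary's moves as they were made in `h`. -/
noncomputable def fixedUtility (B : ℝ) {t : ℕ} (h : Fin t → Round) (l : I) : ℝ :=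
  utility B t (fun s => (l, (h s).2))

/-- A randomized algorithm of the player: a distribution of the next multiplier, given what she
observed in the earlier rounds. -/
structure Algorithm where
  next : (t : ℕ) → Kernel (Fin t → Observation) I
  markov : ∀ t, IsMarkovKernel (next t)

/-- An adaptive, possibly randomized, adversary: a distribution of the next move, given everything
that happened in the earlier rounds. -/
structure Adversary where
  next : (t : ℕ) → Kernel (Fin t → Round) Move
  markov : ∀ t, IsMarkovKernel (next t)

theorem measurable_observe (t : ℕ) :
    Measurable (fun (h : Fin t → Round) (s : Fin t) => (h s).observe) := by
  unfold Round.observe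
  fun_prop

/-- The law of the next round given the earlier ones: the player and the adversary choose
independently of each other. -/
noncomputable def nextRound (alg : Algorithm) (adv : Adversary) (t : ℕ) :
    Kernel (Fin t → Round) Round :=
  ((alg.next t).comap (fun h s => (h s).observe) (measurable_observe t)) ×ₖ adv.next t

/-- The law of the first `t` rounds. -/
noncomputable def gameLaw (alg : Algorithm) (adv : Adversary) : (t : ℕ) → Measure (Fin t → Round)
  | 0 => Measure.dirac Fin.elim0
  | t + 1 =>
    (gameLaw alg adv t ⊗ₘ nextRound alg adv t).map
      (fun p => (Fin.snoc p.1 p.2 : Fin (t + 1) → Round))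

theorem measurable_snoc (t : ℕ) : Measurable
    (fun p : (Fin t → Round) × Round => (Fin.snoc p.1 p.2 : Fin (t + 1) → Round)) := by
  refine measurable_pi_lambda _ fun i => ?_
  induction i using Fin.lastCases with
  | last => simpa using measurable_snd
  | cast j =>
    simp only [Fin.snoc_castSucc]
    fun_prop

instance (alg : Algorithm) (adv : Adversary) (t : ℕ) : IsMarkovKernel (nextRound alg adv t) := by
  have := alg.markov t
  have := adv.markov t
  unfold nextRound
  infer_instance

instance (alg : Algorithm) (adv : Adversary) (t : ℕ) :
    IsProbabilityMeasure (gameLaw alg adv t) := by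
  induction t with
  | zero => unfold gameLaw; infer_instance
  | succ t ih =>
    unfold gameLaw
    exact Measure.isProbabilityMeasure_map (measurable_snoc t).aemeasurable

end FirstPrice

/-! For T ≥ 2 the player runs exponential weights over finitely many experts, but follows the drawn
expert only with probability ρ = B/T and otherwise plays 0, which costs nothing. The experts are
scored by `surplus`, which ignores the budget and counts ties as lost, so their scores can be
computed from what is observed. As the benchmark also uses the realized moves, the regret bound
holds pathwise, even against an adaptive adversary.

The benchmark is budgeted and the experts are not. A fixed multiplier λ with a budget behaves as
without one until its money is gone; from then on it bids 0 and gains only where the competing bid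
is 0. The expert that plays a grid point just above λ up to that round and 1/T afterwards therefore
loses only O(1) against it (`fixedUtility_le_switch`). There are T(T + 1) such experts, so the
regret is O(√(T log T)).

The player's own budget hardly matters: she is active in about ρT = B rounds, each costing at most
1, and each active round in excess costs at most 1 of utility (`playedSurplus_sub_le_utility`). By
Azuma–Hoeffding, with L = log(T/δ), the number of active rounds exceeds B by at most √(TL), and the
played surplus falls short of ρ times the hedged gain by at most √(TL), up to small probability. The
factor ρ is the competitive ratio B/T.

For T = 1 the error √(log(1/δ)) can be arbitrarily small and absorbs no constants; there a uniformly
random multiplier works. Neither algorithm depends on δ. -/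

namespace FirstPrice

/-! ### Sums along a history -/

/-- The sum over the rounds of `h` of a quantity that depends on the round and on the earlier
ones. -/
def cumul {X : Type*} (D : (t : ℕ) → (Fin t → X) → X → ℝ) : (t : ℕ) → (Fin t → X) → ℝ
  | 0, _ => 0
  | t + 1, h => cumul D t (Fin.init h) + D t (Fin.init h) (h (Fin.last t))

theorem measurable_init {X : Type*} [MeasurableSpace X] (t : ℕ) :
    Measurable (fun h : Fin (t + 1) → X => (Fin.init h : Fin t → X)) :=
  measurable_pi_lambda _ fun i => measurable_pi_apply i.castSucc

theorem measurable_cumul {X : Type*} [MeasurableSpace X] {D : (t : ℕ) → (Fin t → X) → X → ℝ}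
    (hD : ∀ t, Measurable fun p : (Fin t → X) × X => D t p.1 p.2) (t : ℕ) :
    Measurable (cumul D t) := by
  induction t with
  | zero => exact measurable_const
  | succ t ih =>
    exact (ih.comp (measurable_init t)).add
      ((hD t).comp ((measurable_init t).prodMk (measurable_pi_apply (Fin.last t))))

theorem cumul_congr {X : Type*} {D D' : (t : ℕ) → (Fin t → X) → X → ℝ} {t : ℕ}
    (hD : ∀ s < t, D s = D' s) : cumul D t = cumul D' t := by
  induction t with
  | zero => rfl
  | succ t ih =>
    ext h
    simp only [cumul, ih fun s hs => hD s (hs.trans t.lt_succ_self), hD t t.lt_succ_self]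

theorem cumul_comp {X Y : Type*} (D : (t : ℕ) → (Fin t → Y) → Y → ℝ) (g : X → Y) (t : ℕ)
    (h : Fin t → X) :
    cumul D t (fun s => g (h s)) = cumul (fun t h x => D t (fun s => g (h s)) (g x)) t h := by
  induction t with
  | zero => rfl
  | succ t ih => exact congrArg (· + _) (ih (Fin.init h))

/-! ### Exponential moments along the game -/

/-- To integrate over one more round, bound the integral over the player's choice uniformly in the
adversary's move. -/
theorem lintegral_gameLaw_succ_le (alg : Algorithm) (adv : Adversary) (t : ℕ)
    {F : (Fin (t + 1) → Round) → ℝ≥0∞} (hF : Measurable F) {A : (Fin t → Round) → ℝ≥0∞}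
    (hA : ∀ h m, ∫⁻ l, F (Fin.snoc h (l, m)) ∂(alg.next t fun s => (h s).observe) ≤ A h) :
    ∫⁻ h, F h ∂gameLaw alg adv (t + 1) ≤ ∫⁻ h, A h ∂gameLaw alg adv t := by
  have := alg.markov t
  have := adv.markov t
  have hFs : Measurable fun p : (Fin t → Round) × Round => F (Fin.snoc p.1 p.2) :=
    hF.comp (measurable_snoc t)
  rw [gameLaw, lintegral_map hF (measurable_snoc t), Measure.lintegral_compProd hFs]
  refine lintegral_mono fun h => ?_
  have hm : Measurable fun r : Round => F (Fin.snoc h r) :=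
    hFs.comp (measurable_const.prodMk measurable_id)
  rw [nextRound, Kernel.prod_apply, Kernel.comap_apply, lintegral_prod_symm _ hm.aemeasurable]
  calc _ ≤ ∫⁻ _, A h ∂(adv.next t h) := lintegral_mono fun m => hA h m
    _ = A h := by simp

/-- Supermartingale argument: the last round contributes a factor of at most exp c, uniformly in the
past and in the adversary's move, so adaptivity does no harm. -/
theorem lintegral_exp_cumul_le (alg : Algorithm) (adv : Adversary)
    {D : (t : ℕ) → (Fin t → Round) → Round → ℝ}
    (hD : ∀ t, Measurable fun p : (Fin t → Round) × Round => D t p.1 p.2) {c : ℝ}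
    (hc : ∀ t h m, ∫⁻ l, ENNReal.ofReal (Real.exp (D t h (l, m)))
      ∂(alg.next t fun s => (h s).observe) ≤ ENNReal.ofReal (Real.exp c)) (t : ℕ) :
    ∫⁻ h, ENNReal.ofReal (Real.exp (cumul D t h)) ∂gameLaw alg adv t
      ≤ ENNReal.ofReal (Real.exp (t * c)) := by
  induction t with
  | zero => simp [cumul]
  | succ t ih =>
    refine (lintegral_gameLaw_succ_le alg adv t (A := fun h =>
      ENNReal.ofReal (Real.exp (cumul D t h)) * ENNReal.ofReal (Real.exp c))
      (measurable_cumul hD _).exp.ennreal_ofReal fun h m => ?_).trans ?_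
    · simp only [cumul, Fin.init_snoc, Fin.snoc_last, Real.exp_add,
        ENNReal.ofReal_mul (Real.exp_nonneg _)]
      rw [lintegral_const_mul]
      · gcongr
        exact hc t h m
      · exact ((hD t).comp (measurable_const.prodMk
          (measurable_id.prodMk measurable_const))).exp.ennreal_ofReal
    · rw [lintegral_mul_const _ (measurable_cumul hD _).exp.ennreal_ofReal]
      refine (mul_le_mul_left ih _).trans ?_
      rw [← ENNReal.ofReal_mul (Real.exp_nonneg _), ← Real.exp_add]
      push_cast
      rw [add_mul, one_mul]

/-- Hoeffding's lemma, with an upper bound in place of the mean. -/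
theorem lintegral_exp_le_of_mem_Icc {Ω : Type*} [MeasurableSpace Ω] (μ : Measure Ω)
    [IsProbabilityMeasure μ] {f : Ω → ℝ} (hf : Measurable f) {x a θ : ℝ}
    (hx : ∀ ω, f ω ∈ Set.Icc x (x + 1)) (ha : ∫ ω, f ω ∂μ ≤ a) (hθ : 0 ≤ θ) :
    ∫⁻ ω, ENNReal.ofReal (Real.exp (θ * (f ω - a))) ∂μ
      ≤ ENNReal.ofReal (Real.exp (θ ^ 2 / 8)) := by
  have hs := hasSubgaussianMGF_of_mem_Icc (μ := μ) hf.aemeasurable (ae_of_all _ hx)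
  calc _ ≤ ∫⁻ ω, ENNReal.ofReal (Real.exp (θ * (f ω - ∫ ω, f ω ∂μ))) ∂μ := by gcongr
    _ = ENNReal.ofReal (∫ ω, Real.exp (θ * (f ω - ∫ ω, f ω ∂μ)) ∂μ) :=
      (ofReal_integral_eq_lintegral_ofReal (hs.integrable_exp_mul θ)
        (ae_of_all _ fun _ => Real.exp_nonneg _)).symm
    _ ≤ _ := by
      refine ENNReal.ofReal_le_ofReal ((hs.mgf_le θ).trans (Real.exp_le_exp.2 (le_of_eq ?_)))
      simp
      ring

/-- The Azuma–Hoeffding inequality for the game. -/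
theorem gameLaw_cumul_ge_le (alg : Algorithm) (adv : Adversary)
    {f : (t : ℕ) → (Fin t → Round) → Round → ℝ} {a : (t : ℕ) → (Fin t → Round) → Move → ℝ}
    (hf : ∀ t, Measurable fun p : (Fin t → Round) × Round => f t p.1 p.2)
    (ha : ∀ t, Measurable fun p : (Fin t → Round) × Move => a t p.1 p.2)
    {x : ℝ} (hx : ∀ t h r, f t h r ∈ Set.Icc x (x + 1))
    (hfa : ∀ t h m, ∫ l, f t h (l, m) ∂(alg.next t fun s => (h s).observe) ≤ a t h m)
    {T : ℕ} (hT : 0 < T) {L : ℝ} (hL : 0 ≤ L) :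
    gameLaw alg adv T {h | √(T * L) ≤ cumul (fun t h r => f t h r - a t h r.2) T h}
      ≤ ENNReal.ofReal (Real.exp (-L)) := by
  have hT' : (0 : ℝ) < T := by exact_mod_cast hT
  set s := √(T * L) with hs
  have hs2 : s ^ 2 = T * L := Real.sq_sqrt (by positivity)
  -- The optimal 4s/T would give the exponent -2L; this choice gives L/2 - 2L = -3L/2, which is
  -- enough.
  set θ := 2 * s / T with hθ
  have hθ0 : 0 ≤ θ := by positivity
  have hD : ∀ t, Measurable fun p : (Fin t → Round) × Round =>
      θ * (f t p.1 p.2 - a t p.1 p.2.2) := fun t =>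
    ((hf t).sub ((ha t).comp (measurable_fst.prodMk
      (measurable_snd.comp measurable_snd)))).const_mul θ
  have key := lintegral_exp_cumul_le alg adv (D := fun t h r => θ * (f t h r - a t h r.2)) hD (c := θ ^ 2 / 8) (fun t h m => by
    have := alg.markov t
    exact lintegral_exp_le_of_mem_Icc _ (f := fun l => f t h (l, m))
      ((hf t).comp (measurable_const.prodMk (measurable_id.prodMk measurable_const)))
      (fun l => hx t h (l, m)) (hfa t h m) hθ0) T
  have hcum : ∀ (t : ℕ) h, cumul (fun t h r => θ * (f t h r - a t h r.2)) t h
      = θ * cumul (fun t h r => f t h r - a t h r.2) t h := by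
    intro t
    induction t with
    | zero => simp [cumul]
    | succ t ih => intro h; simp only [cumul, ih]; ring
  calc _ ≤ gameLaw alg adv T {h | ENNReal.ofReal (Real.exp (θ * s)) ≤ ENNReal.ofReal
          (Real.exp (cumul (fun t h r => θ * (f t h r - a t h r.2)) T h))} := by
        refine measure_mono fun h hh => ?_
        simp only [Set.mem_ofPred_eq, hcum] at hh ⊢
        gcongr
    _ ≤ (∫⁻ h, ENNReal.ofReal (Real.exp (cumul (fun t h r => θ * (f t h r - a t h r.2)) T h))
          ∂gameLaw alg adv T) / ENNReal.ofReal (Real.exp (θ * s)) :=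
        meas_ge_le_lintegral_div (measurable_cumul hD T).exp.ennreal_ofReal.aemeasurable
          (by simp [Real.exp_pos]) ENNReal.ofReal_ne_top
    _ ≤ ENNReal.ofReal (Real.exp (T * (θ ^ 2 / 8))) / ENNReal.ofReal (Real.exp (θ * s)) := by
        gcongr
    _ = ENNReal.ofReal (Real.exp (T * (θ ^ 2 / 8) - θ * s)) := by
        rw [← ENNReal.ofReal_div_of_pos (Real.exp_pos _), Real.exp_sub]
    _ ≤ _ := by
        refine ENNReal.ofReal_le_ofReal (Real.exp_le_exp.2 ?_)
        have h1 : T * (θ ^ 2 / 8) = L / 2 := by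
          rw [hθ]; field_simp; rw [hs2]; ring
        have h2 : θ * s = 2 * L := by
          rw [hθ]; field_simp; rw [hs2]
        rw [h1, h2]; linarith

/-! ### Bidding without a budget -/

/-- The utility from the multiplier `l` when ties are lost and the budget does not bind. -/
noncomputable def surplus (l v : I) (d : ℝ≥0) : ℝ := if (d : ℝ) < l * v then v - l * v else 0

theorem surplus_nonneg (l v : I) (d : ℝ≥0) : 0 ≤ surplus l v d := by
  unfold surplus
  have := mul_le_of_le_one_left v.2.1 l.2.2
  split_ifs <;> linarith

theorem surplus_le_one (l v : I) (d : ℝ≥0) : surplus l v d ≤ 1 := by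
  unfold surplus
  have := mul_nonneg l.2.1 v.2.1
  have := v.2.2
  split_ifs <;> linarith

@[simp]
theorem surplus_zero (v : I) (d : ℝ≥0) : surplus 0 v d = 0 := by simp [surplus]

theorem measurable_surplus : Measurable fun p : I × I × ℝ≥0 => surplus p.1 p.2.1 p.2.2 := by
  unfold surplus
  refine Measurable.ite (measurableSet_lt ?_ ?_) ?_ measurable_const <;> fun_prop

/-- A slightly larger multiplier does almost as well as one that wins its ties. -/
theorem sub_mul_le_surplus_add {l l' v : I} {d : ℝ≥0} {ε : ℝ} (hl : (l : ℝ) < l' ∨ l = 1)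
    (hε : (l' : ℝ) ≤ l + ε) (hε0 : 0 ≤ ε) (hd : (d : ℝ) ≤ l * v) :
    (v : ℝ) - l * v ≤ surplus l' v d + ε := by
  rcases hl with hl | rfl
  · rcases v.2.1.eq_or_lt with hv | hv
    · rw [← hv]
      linarith [surplus_nonneg l' v d]
    · rw [surplus, if_pos (hd.trans_lt (mul_lt_mul_of_pos_right hl hv))]
      nlinarith [v.2.2]
  -- There is no multiplier above 1, but bidding the full value gains nothing anyway.
  · simp only [Set.Icc.coe_one, one_mul]
    linarith [surplus_nonneg l' v d]

/-! ### Budget and utility -/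

theorem Round.bid_le (b : ℝ) (r : Round) : r.bid b ≤ r.mult * r.value := min_le_left _ _

theorem Round.mult_mul_value_le (r : Round) : r.mult * r.value ≤ r.value :=
  mul_le_of_le_one_left r.2.1.2.1 r.1.2.2

theorem remaining_nonneg {B : ℝ} (hB : 0 ≤ B) (t : ℕ) (h : Fin t → Round) :
    0 ≤ remaining B t h := by
  induction t with
  | zero => exact hB
  | succ t ih =>
    simp only [remaining]
    split_ifs
    · exact sub_nonneg.2 (min_le_right _ _)
    · exact ih _

/-- The number of rounds with a nonzero multiplier. -/
noncomputable def activity : (t : ℕ) → (Fin t → Round) → ℝ :=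
  cumul fun _ _ r => if r.1 = 0 then 0 else 1

/-- The sum of the surpluses of the multipliers played. -/
noncomputable def playedSurplus : (t : ℕ) → (Fin t → Round) → ℝ :=
  cumul fun _ _ r => surplus r.1 r.2.1 r.2.2.1

/-- A round costs at most the value, hence at most 1, and the multiplier 0 costs nothing. -/
theorem sub_activity_le_remaining {B : ℝ} (hB : 0 ≤ B) (t : ℕ) (h : Fin t → Round) :
    B - activity t h ≤ remaining B t h := by
  induction t with
  | zero => simp [activity, cumul, remaining]
  | succ t ih =>
    have ih := ih (Fin.init h)
    have hb := remaining_nonneg hB t (Fin.init h)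
    have h1 := (h (Fin.last t)).bid_le (remaining B t (Fin.init h))
    have h2 := (h (Fin.last t)).mult_mul_value_le
    have h3 : (h (Fin.last t)).value ≤ 1 := (h (Fin.last t)).2.1.2.2
    simp only [activity, cumul, remaining] at ih ⊢
    by_cases h0 : (h (Fin.last t)).1 = 0
    · have : (h (Fin.last t)).mult = 0 := by simp [Round.mult, h0]
      rw [this, zero_mul] at h1
      rw [if_pos h0]
      split_ifs <;> linarith
    · rw [if_neg h0]
      split_ifs <;> linarith

/-- The budget costs at most the number of active rounds in excess of it. -/
theorem playedSurplus_sub_le_utility {B : ℝ} (hB : 0 ≤ B) (t : ℕ) (h : Fin t → Round) :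
    playedSurplus t h - max 0 (activity t h - B + 1) ≤ utility B t h := by
  induction t with
  | zero =>
    have := le_max_left 0 (0 - B + 1)
    simp only [activity, playedSurplus, cumul, utility]
    linarith
  | succ t ih =>
    have ih := ih (Fin.init h)
    have hb := sub_activity_le_remaining hB t (Fin.init h)
    have h1 := (h (Fin.last t)).bid_le (remaining B t (Fin.init h))
    have h2 := (h (Fin.last t)).mult_mul_value_le
    have h3 : (h (Fin.last t)).value ≤ 1 := (h (Fin.last t)).2.1.2.2
    have hs := surplus_le_one (h (Fin.last t)).1 (h (Fin.last t)).2.1 (h (Fin.last t)).2.2.1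
    simp only [activity, playedSurplus, cumul, utility] at ih hb ⊢
    set b := remaining B t (Fin.init h)
    set r := h (Fin.last t)
    set N := cumul (fun _ _ r => if r.1 = 0 then 0 else 1) t (Fin.init h)
    by_cases h0 : r.1 = 0
    · rw [if_pos h0, h0, surplus_zero, add_zero, add_zero]
      split_ifs <;> linarith
    · rw [if_neg h0]
      -- Either at least 1 of the budget is left and the bid is not capped, or the maximum is
      -- already positive and grows by 1, which pays for the whole surplus of the round.
      rcases le_or_gt 1 (B - N) with hN | hN
      · have hbid : r.bid b = r.mult * r.value := min_eq_left (by linarith)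
        have hgain : surplus r.1 r.2.1 r.2.2.1 ≤
            open Classical in if r.Wins b then r.value - r.bid b else 0 := by
          unfold surplus
          split_ifs with hw hW
          · rw [hbid]
            exact le_rfl
          · exact absurd (Or.inl (hbid ▸ hw)) hW
          · linarith
          · exact le_rfl
        have : max 0 (N - B + 1) ≤ max 0 (N + 1 - B + 1) := max_le_max le_rfl (by linarith)
        linarith
      · rw [max_eq_right (by linarith)] at ih
        rw [max_eq_right (by linarith)]
        split_ifs <;> linarith

/-- A fixed multiplier `l` with a budget is almost dominated by playing `l'`, slightly above `l`,
up to some round, and a small multiplier `z` from then on. -/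
theorem fixedUtility_le_switch {B : ℝ} (hB : 0 ≤ B) {l l' z : I} {ε : ℝ}
    (hl : (l : ℝ) < l' ∨ l = 1) (hε : (l' : ℝ) ≤ l + ε) (hz : 0 < (z : ℝ)) (hzε : (z : ℝ) ≤ ε)
    (t : ℕ) (h : Fin t → Round) :
    ∃ τ ≤ t, fixedUtility B h l ≤
      cumul (fun s _ r => surplus (if s < τ then l' else z) r.2.1 r.2.2.1) t h + 1 + t * ε := by
  have hε0 : 0 ≤ ε := hz.le.trans hzε
  have hswitch : ∀ t, cumul (fun s _ (r : Round) =>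
      surplus (if s < t then l' else z) r.2.1 r.2.2.1) t
      = cumul (fun _ _ r => surplus l' r.2.1 r.2.2.1) t := fun t =>
    cumul_congr fun s hs => by simp only [if_pos hs]
  -- The extra 1 may be spent only once, so the induction separates histories on which no capped bid
  -- has won from those on which the budget is exactly 0.
  suffices H : ∀ (t : ℕ) (h : Fin t → Round),
      fixedUtility B h l ≤ cumul (fun _ _ r => surplus l' r.2.1 r.2.2.1) t h + t * ε ∨
      remaining B t (fun s => (l, (h s).2)) = 0 ∧ ∃ τ ≤ t, fixedUtility B h l ≤
        cumul (fun s _ r => surplus (if s < τ then l' else z) r.2.1 r.2.2.1) t h + 1 + t * ε by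
    rcases H t h with H | ⟨-, H⟩
    · refine ⟨t, le_rfl, H.trans ?_⟩
      rw [hswitch]
      linarith
    · exact H
  intro t
  induction t with
  | zero => intro h; left; simp [fixedUtility, utility, cumul]
  | succ t ih =>
    intro h
    have hb := remaining_nonneg hB t (fun s => (l, (Fin.init h s).2))
    set v := (h (Fin.last t)).2.1
    set d := (h (Fin.last t)).2.2.1
    have hstep : fixedUtility B h l = fixedUtility B (Fin.init h) l +
        open Classical in
        if Round.Wins (remaining B t fun s => (l, (Fin.init h s).2)) (l, (h (Fin.last t)).2) then
          (v : ℝ) - min (l * v : ℝ) (remaining B t fun s => (l, (Fin.init h s).2)) else 0 := rfl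
    have hrem : remaining B (t + 1) (fun s => (l, (h s).2)) =
        open Classical in
        if Round.Wins (remaining B t fun s => (l, (Fin.init h s).2)) (l, (h (Fin.last t)).2) then
          (remaining B t fun s => (l, (Fin.init h s).2))
            - min (l * v : ℝ) (remaining B t fun s => (l, (Fin.init h s).2))
        else remaining B t fun s => (l, (Fin.init h s).2) := rfl
    have hW : ∀ b, Round.Wins b (l, (h (Fin.last t)).2) → (d : ℝ) ≤ min (l * v : ℝ) b := by
      rintro b (h | h)
      · exact h.le
      · exact h.1.le
    rw [hstep, hrem]
    set b := remaining B t fun s => (l, (Fin.init h s).2)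
    have hsl := surplus_nonneg l' v d
    have hsz := surplus_nonneg z v d
    have hv1 := v.2.2
    simp only [cumul]
    push_cast
    rcases ih (Fin.init h) with ih | ⟨h0, τ, hτ, ih⟩
    · by_cases hw : Round.Wins b (l, (h (Fin.last t)).2)
      · rw [if_pos hw, if_pos hw]
        have hd := hW b hw
        rcases le_total (l * v : ℝ) b with hlb | hlb
        · left
          rw [min_eq_left hlb] at hd ⊢
          linarith [sub_mul_le_surplus_add hl hε hε0 hd]
        · right
          rw [min_eq_right hlb]
          -- The exhausting round t is the first one in which the expert plays `z`; its gain of at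
          -- most 1 is paid by the extra 1.
          refine ⟨sub_self b, t, Nat.le_succ t, ?_⟩
          rw [hswitch, if_neg (lt_irrefl t)]
          linarith
      · left
        rw [if_neg hw]
        linarith
    · right
      rw [show b = 0 from h0]
      have hm : min (l * v : ℝ) 0 = 0 := min_eq_right (mul_nonneg l.2.1 v.2.1)
      refine ⟨by rw [hm]; simp, τ, Nat.le_succ_of_le hτ, ?_⟩
      rw [if_neg (not_lt.2 hτ)]
      split_ifs with hw
      -- Without money, `l` acts like the multiplier 0 and wins only if d = 0; then `z` wins too
      -- unless the value is 0.
      · have hd := hW 0 hw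
        rw [hm] at hd ⊢
        have := sub_mul_le_surplus_add (l := 0) (l' := z) (v := v) (d := d) (ε := ε)
          (Or.inl hz) (by simpa using hzε) hε0 (by simpa using hd)
        simp only [Set.Icc.coe_zero, zero_mul] at this
        linarith
      · linarith

/-! ### Hedging over a finite family of experts -/

/-- The total surplus of an expert who plays the multiplier `play s` in round `s`. -/
noncomputable def expertGain (play : ℕ → I) : (t : ℕ) → (Fin t → Observation) → ℝ :=
  cumul fun s _ x => surplus (play s) x.2.1 x.2.2

/-- The exponential weight of an expert. -/
noncomputable def hedgeWeight {E : Type} [Fintype E] (η : ℝ) (play : E → ℕ → I) (t : ℕ)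
    (o : Fin t → Observation) (e : E) : ℝ :=
  Real.exp (η * expertGain (play e) t o) / ∑ i, Real.exp (η * expertGain (play i) t o)

/-- The total expected surplus of the exponential weights algorithm. -/
noncomputable def hedgeGain {E : Type} [Fintype E] (η : ℝ) (play : E → ℕ → I) :
    (t : ℕ) → (Fin t → Observation) → ℝ :=
  cumul fun t o x => ∑ e, hedgeWeight η play t o e * surplus (play e t) x.2.1 x.2.2

section Hedge

variable {E : Type} [Fintype E] (η : ℝ) (play : E → ℕ → I) (t : ℕ)

theorem hedgeWeight_nonneg (o : Fin t → Observation) (e : E) : 0 ≤ hedgeWeight η play t o e := by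
  unfold hedgeWeight
  positivity

theorem sum_hedgeWeight [Nonempty E] (o : Fin t → Observation) :
    ∑ e, hedgeWeight η play t o e = 1 := by
  simp only [hedgeWeight, ← Finset.sum_div]
  exact div_self (Finset.sum_pos (fun _ _ => Real.exp_pos _) Finset.univ_nonempty).ne'

theorem measurable_surplus_observation (l : I) :
    Measurable fun x : Observation => surplus l x.2.1 x.2.2 :=
  measurable_surplus.comp (measurable_const.prodMk measurable_snd)

theorem measurable_expertGain (p : ℕ → I) : Measurable (expertGain p t) :=
  measurable_cumul (fun s => (measurable_surplus_observation (p s)).comp measurable_snd) t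

theorem measurable_hedgeWeight (e : E) : Measurable fun o => hedgeWeight η play t o e := by
  unfold hedgeWeight
  have := fun i => measurable_expertGain t (play i)
  fun_prop

/-- Since exp(ηy) ≤ 1 + ηy + η² for y in [0, 1], a round with mean surplus m multiplies the total
weight by at most 1 + ηm + η² ≤ exp(ηm + η²). -/
theorem sum_exp_expertGain_le [Nonempty E] {η : ℝ} (hη0 : 0 ≤ η) (hη1 : η ≤ 1)
    (o : Fin t → Observation) :
    ∑ e, Real.exp (η * expertGain (play e) t o)
      ≤ Fintype.card E * Real.exp (η * hedgeGain η play t o + t * η ^ 2) := by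
  induction t with
  | zero => simp [expertGain, hedgeGain, cumul]
  | succ t ih =>
    have ih := ih (Fin.init o)
    set W := ∑ e, Real.exp (η * expertGain (play e) t (Fin.init o)) with hW
    have hW0 : 0 < W := Finset.sum_pos (fun _ _ => Real.exp_pos _) Finset.univ_nonempty
    set x := o (Fin.last t)
    set w := hedgeWeight η play t (Fin.init o) with hw
    set m := ∑ e, w e * surplus (play e t) x.2.1 x.2.2 with hm
    have hexp : ∀ y : ℝ, 0 ≤ y → y ≤ 1 → Real.exp (η * y) ≤ 1 + η * y + η ^ 2 := by
      intro y hy0 hy1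
      have h1 : |η * y| ≤ 1 := by
        rw [abs_of_nonneg (by positivity)]
        exact mul_le_one₀ hη1 hy0 hy1
      have h2 := (abs_le.1 (Real.abs_exp_sub_one_sub_id_le h1)).2
      have h3 : (η * y) ^ 2 ≤ η ^ 2 :=
        pow_le_pow_left₀ (by positivity) (mul_le_of_le_one_right hη0 hy1) 2
      linarith
    calc ∑ e, Real.exp (η * expertGain (play e) (t + 1) o)
        = ∑ e, W * (w e * Real.exp (η * surplus (play e t) x.2.1 x.2.2)) := by
          refine Finset.sum_congr rfl fun e _ => ?_
          rw [hw, hedgeWeight, ← hW]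
          simp only [expertGain, cumul, mul_add, Real.exp_add]
          field_simp
          rfl
      _ ≤ ∑ e, W * (w e * (1 + η * surplus (play e t) x.2.1 x.2.2 + η ^ 2)) := by
          gcongr with e
          · exact hedgeWeight_nonneg ..
          · exact hexp _ (surplus_nonneg ..) (surplus_le_one ..)
      _ = W * (η * m + η ^ 2 + 1) := by
          rw [← Finset.mul_sum]
          congr 1
          have h1 : ∑ e, w e = 1 := sum_hedgeWeight ..
          calc _ = (∑ e, w e) + η * m + (∑ e, w e) * η ^ 2 := by
                rw [hm, Finset.mul_sum, Finset.sum_mul, ← Finset.sum_add_distrib,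
                  ← Finset.sum_add_distrib]
                exact Finset.sum_congr rfl fun e _ => by ring
            _ = _ := by rw [h1]; ring
      _ ≤ (Fintype.card E * Real.exp (η * hedgeGain η play t (Fin.init o) + t * η ^ 2))
            * Real.exp (η * m + η ^ 2) := by
          have hm0 : 0 ≤ m := Finset.sum_nonneg fun e _ =>
            mul_nonneg (hedgeWeight_nonneg ..) (surplus_nonneg ..)
          exact mul_le_mul ih (Real.add_one_le_exp _) (by positivity) (by positivity)
      _ = _ := by
          rw [mul_assoc, ← Real.exp_add]
          simp only [hedgeGain, cumul]
          congr 2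
          push_cast
          ring

/-- The regret bound of the exponential weights algorithm. -/
theorem mul_expertGain_le [Nonempty E] {η : ℝ} (hη0 : 0 ≤ η) (hη1 : η ≤ 1)
    (o : Fin t → Observation) (e : E) :
    η * expertGain (play e) t o
      ≤ η * hedgeGain η play t o + t * η ^ 2 + Real.log (Fintype.card E) := by
  have hc : (0 : ℝ) < Fintype.card E := by exact_mod_cast Fintype.card_pos
  rw [← Real.exp_le_exp, Real.exp_add _ (Real.log _), Real.exp_log hc,
    mul_comm (Real.exp _)]
  exact (Finset.single_le_sum (f := fun e => Real.exp (η * expertGain (play e) t o))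
    (fun _ _ => Real.exp_nonneg _) (Finset.mem_univ e)).trans
      (sum_exp_expertGain_le play t hη0 hη1 o)

/-- Follow an expert drawn by exponential weights with probability `ρ`, and otherwise play `0`. -/
noncomputable def hedgeLaw (ρ : ℝ) (o : Fin t → Observation) : Measure I :=
  ENNReal.ofReal (1 - ρ) • Measure.dirac 0
    + ∑ e, ENNReal.ofReal (ρ * hedgeWeight η play t o e) • Measure.dirac (play e t)

theorem measurable_hedgeLaw (ρ : ℝ) : Measurable (hedgeLaw η play t ρ) := by
  refine Measure.measurable_of_measurable_coe _ fun s hs => ?_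
  simp only [hedgeLaw, Measure.add_apply, Measure.smul_apply, Measure.finsetSum_apply, smul_eq_mul]
  have := measurable_hedgeWeight η play t
  fun_prop

theorem isProbabilityMeasure_hedgeLaw [Nonempty E] {ρ : ℝ} (hρ0 : 0 ≤ ρ) (hρ1 : ρ ≤ 1)
    (o : Fin t → Observation) : IsProbabilityMeasure (hedgeLaw η play t ρ o) := by
  constructor
  simp only [hedgeLaw, Measure.add_apply, Measure.smul_apply, Measure.finsetSum_apply,
    smul_eq_mul, measure_univ, mul_one]
  rw [← ENNReal.ofReal_sum_of_nonneg fun e _ => mul_nonneg hρ0 (hedgeWeight_nonneg ..),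
    ← Finset.mul_sum, sum_hedgeWeight, ← ENNReal.ofReal_add (by linarith) (by linarith)]
  simp

theorem integral_hedgeLaw {ρ : ℝ} (hρ0 : 0 ≤ ρ) (hρ1 : ρ ≤ 1) (o : Fin t → Observation)
    (f : I → ℝ) :
    ∫ l, f l ∂hedgeLaw η play t ρ o
      = (1 - ρ) * f 0 + ρ * ∑ e, hedgeWeight η play t o e * f (play e t) := by
  have hd : ∀ (c : ℝ) l, Integrable f (ENNReal.ofReal c • Measure.dirac l) := fun c l =>
    (integrable_dirac (by simp)).smul_measure ENNReal.ofReal_ne_top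
  rw [hedgeLaw, integral_add_measure (hd _ _) (integrable_finsetSum_measure.2 fun e _ => hd _ _),
    integral_finsetSum_measure fun e _ => hd _ _, Finset.mul_sum]
  simp only [integral_smul_measure, integral_dirac, smul_eq_mul,
    ENNReal.toReal_ofReal (sub_nonneg.2 hρ1),
    ENNReal.toReal_ofReal (mul_nonneg hρ0 (hedgeWeight_nonneg η play t o _)), mul_assoc]

/-- The algorithm that follows `hedgeLaw` in every round. -/
noncomputable def hedgeAlgorithm [Nonempty E] {ρ : ℝ} (hρ0 : 0 ≤ ρ) (hρ1 : ρ ≤ 1) : Algorithm where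
  next t := ⟨hedgeLaw η play t ρ, measurable_hedgeLaw η play t ρ⟩
  markov t := ⟨fun o => isProbabilityMeasure_hedgeLaw η play t hρ0 hρ1 o⟩

variable [Nonempty E] {ρ : ℝ} (hρ0 : 0 ≤ ρ) (hρ1 : ρ ≤ 1) (adv : Adversary) {T : ℕ} (hT : 0 < T)
  {L : ℝ} (hL : 0 ≤ L)
include hT hL

/-- As the multiplier 0 has surplus 0, the conditional mean of the played surplus is ρ times the
hedged one. Azuma bounds upper deviations, hence the minus signs. -/
theorem hedge_playedSurplus_tail :
    gameLaw (hedgeAlgorithm η play hρ0 hρ1) adv T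
        {h | √(T * L) ≤ ρ * hedgeGain η play T (fun s => (h s).observe) - playedSurplus T h}
      ≤ ENNReal.ofReal (Real.exp (-L)) := by
  have hcum : ∀ (t : ℕ) (h : Fin t → Round),
      ρ * hedgeGain η play t (fun s => (h s).observe) - playedSurplus t h
        = cumul (fun t h r => -surplus r.1 r.2.1 r.2.2.1
            - -(ρ * ∑ e, hedgeWeight η play t (fun s => (h s).observe) e
                * surplus (play e t) r.2.1 r.2.2.1)) t h := by
    intro t
    induction t with
    | zero => simp [hedgeGain, playedSurplus, cumul]
    | succ t ih =>
      intro h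
      rw [cumul, ← ih]
      simp only [hedgeGain, playedSurplus, cumul, Round.observe]
      rw [show (Fin.init fun s => ((h s).1, (h s).2.1, (h s).2.2.1))
        = fun s => ((Fin.init h s).1, (Fin.init h s).2.1, (Fin.init h s).2.2.1) from rfl]
      ring
  simp only [hcum]
  refine gameLaw_cumul_ge_le _ adv (f := fun _ _ r => -surplus r.1 r.2.1 r.2.2.1)
    (a := fun t h m => -(ρ * ∑ e, hedgeWeight η play t (fun s => (h s).observe) e
      * surplus (play e t) m.1 m.2.1)) (x := -1) (fun t => ?_) (fun t => ?_) (fun t h r => ?_)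
      (fun t h m => ?_) hT hL
  · exact (measurable_surplus.comp (by fun_prop :
      Measurable fun p : (Fin t → Round) × Round => (p.2.1, p.2.2.1, p.2.2.2.1))).neg
  · refine ((Finset.measurable_sum _ fun e _ => ?_).const_mul ρ).neg
    refine ((measurable_hedgeWeight η play t e).comp
      ((measurable_observe t).comp measurable_fst)).mul ?_
    exact measurable_surplus.comp (by fun_prop :
      Measurable fun p : (Fin t → Round) × Move => (play e t, p.2.1, p.2.2.1))
  · have h0 := surplus_nonneg r.1 r.2.1 r.2.2.1
    have h1 := surplus_le_one r.1 r.2.1 r.2.2.1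
    constructor <;> linarith
  · refine ((integral_neg _).trans (congrArg _ ((integral_hedgeLaw η play t hρ0 hρ1 _
      fun l => surplus l m.1 m.2.1).trans ?_))).le
    simp

/-- A nonzero multiplier has conditional probability at most ρ. -/
theorem hedge_activity_tail :
    gameLaw (hedgeAlgorithm η play hρ0 hρ1) adv T {h | √(T * L) ≤ activity T h - T * ρ}
      ≤ ENNReal.ofReal (Real.exp (-L)) := by
  have hcum : ∀ (t : ℕ) (h : Fin t → Round), activity t h - t * ρ
        = cumul (fun _ _ r => (if r.1 = 0 then 0 else 1) - ρ) t h := by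
    intro t
    induction t with
    | zero => simp [activity, cumul]
    | succ t ih =>
      intro h
      rw [cumul, ← ih]
      simp only [activity, cumul]
      push_cast
      ring
  simp only [hcum]
  refine gameLaw_cumul_ge_le _ adv (f := fun _ _ r => if r.1 = 0 then 0 else 1)
    (a := fun _ _ _ => ρ) (x := 0) (fun t => ?_) (fun t => measurable_const) (fun t h r => ?_)
      (fun t h m => ?_) hT hL
  · exact Measurable.ite (measurableSet_eq_fun (by fun_prop) measurable_const)
      measurable_const measurable_const
  · split_ifs <;> norm_num
  · refine (integral_hedgeLaw η play t hρ0 hρ1 _ fun l => if l = 0 then (0 : ℝ) else 1).le.trans ?_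
    rw [if_pos rfl, mul_zero, zero_add]
    refine mul_le_of_le_one_right hρ0 ?_
    refine (Finset.sum_le_sum fun e _ => ?_).trans
      (sum_hedgeWeight η play t fun s => (h s).observe).le
    refine mul_le_of_le_one_right (hedgeWeight_nonneg ..) ?_
    split_ifs <;> norm_num

end Hedge

/-! ### At least two rounds -/

/-- The multipliers `1 / T, 2 / T, …, 1`. -/
noncomputable def gridPoint {T : ℕ} (i : Fin T) : I :=
  ⟨((i : ℕ) + 1) / T, by positivity, by
    have : (0 : ℝ) < T := by exact_mod_cast i.pos
    rw [div_le_one this]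
    exact_mod_cast i.2⟩

theorem exists_gridPoint {T : ℕ} (hT : 0 < T) (l : I) :
    ∃ i : Fin T, ((l : ℝ) < gridPoint i ∨ l = 1) ∧ (gridPoint i : ℝ) ≤ l + 1 / T := by
  have hT' : (0 : ℝ) < T := by exact_mod_cast hT
  have hl0 := l.2.1
  rcases eq_or_ne l 1 with rfl | hl
  · refine ⟨⟨0, hT⟩, Or.inr rfl, ?_⟩
    simp [gridPoint]
  · have hl1 : (l : ℝ) < 1 := lt_of_le_of_ne l.2.2 fun h => hl (Subtype.ext h)
    have hlT : 0 ≤ (l : ℝ) * T := by positivity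
    -- This index stands for (⌊lT⌋ + 1)/T, the first grid point strictly above `l`.
    refine ⟨⟨⌊(l : ℝ) * T⌋₊, (Nat.floor_lt hlT).2 (mul_lt_of_lt_one_left hT' hl1)⟩, Or.inl ?_, ?_⟩
    · simp only [gridPoint]
      rw [lt_div_iff₀ hT']
      exact Nat.lt_floor_add_one _
    · simp only [gridPoint]
      rw [add_div]
      gcongr
      rw [div_le_iff₀ hT']
      exact Nat.floor_le hlT

/-- The expert `(i, τ)` plays the multiplier `gridPoint i` before round `τ`, and the smallest grid
point from then on. -/
noncomputable def switchingExpert {T : ℕ} (hT : 0 < T) (e : Fin T × Fin (T + 1)) (s : ℕ) : I :=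
  if s < e.2 then gridPoint e.1 else gridPoint ⟨0, hT⟩

/-- The 2 is 1 for the exhausting round plus T · (1/T) for rounding to the grid. -/
theorem exists_fixedUtility_le_expertGain {T : ℕ} (hT : 0 < T) {B : ℝ} (hB : 0 ≤ B)
    (h : Fin T → Round) (l : I) :
    ∃ e, fixedUtility B h l
      ≤ expertGain (switchingExpert hT e) T (fun s => (h s).observe) + 2 := by
  have hT' : (0 : ℝ) < T := by exact_mod_cast hT
  obtain ⟨i, hi, hi'⟩ := exists_gridPoint hT l
  obtain ⟨τ, hτ, H⟩ := fixedUtility_le_switch hB hi hi' (z := gridPoint ⟨0, hT⟩)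
    (by simp only [gridPoint]; positivity) (by simp [gridPoint]) T h
  refine ⟨(i, ⟨τ, Nat.lt_succ_of_le hτ⟩), ?_⟩
  rw [expertGain, cumul_comp]
  rw [mul_one_div_cancel hT'.ne', add_assoc, one_add_one_eq_two] at H
  exact H

theorem log_card_experts_le {T : ℕ} (hT : 2 ≤ T) :
    Real.log (Fintype.card (Fin T × Fin (T + 1))) ≤ 3 * Real.log T := by
  have hT' : (2 : ℝ) ≤ T := by exact_mod_cast hT
  have h3 : 3 * Real.log T = Real.log ((T : ℝ) ^ 3) := by simp
  rw [h3]
  refine Real.log_le_log (by simp; positivity) ?_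
  simp only [Fintype.card_prod, Fintype.card_fin]
  push_cast
  nlinarith [mul_le_mul hT' hT' (by norm_num) (by linarith),
    mul_nonneg (by linarith : (0 : ℝ) ≤ T) (by nlinarith : (0 : ℝ) ≤ T ^ 2 - T - 1)]

/-- The regret of exponential weights over `switchingExpert`. -/
theorem exists_rate {T : ℕ} (hT : 2 ≤ T) : ∃ η : ℝ, ∀ (B : ℝ) (h : Fin T → Round) (l : I), 0 ≤ B →
    fixedUtility B h l ≤ hedgeGain η (switchingExpert (two_pos.trans_le hT)) T
      (fun s => (h s).observe) + 4 * √(T * Real.log T) + 2 := by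
  have hT' : (2 : ℝ) ≤ T := by exact_mod_cast hT
  have hlog : 0 < Real.log T := Real.log_pos (by linarith)
  set s := √(T * Real.log T) with hs
  have hs0 : 0 < s := Real.sqrt_pos.2 (by positivity)
  have hs2 : s ^ 2 = T * Real.log T := Real.sq_sqrt (by positivity)
  have hη1 : s / T ≤ 1 := by
    rw [div_le_one (by positivity), hs, Real.sqrt_le_left (by positivity), sq]
    gcongr
    linarith [Real.log_le_sub_one_of_pos (by positivity : (0 : ℝ) < T)]
  -- With η = s/T = √(log T / T), both Tη² and log T equal ηs; the regret is s + 3s.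
  refine ⟨s / T, fun B h l hB => ?_⟩
  have : Nonempty (Fin T) := ⟨⟨0, two_pos.trans_le hT⟩⟩
  obtain ⟨e, he⟩ := exists_fixedUtility_le_expertGain (two_pos.trans_le hT) hB h l
  have hr := mul_expertGain_le (switchingExpert (two_pos.trans_le hT)) T (by positivity) hη1
    (fun s => (h s).observe) e
  have h1 : T * (s / T) ^ 2 = s / T * s := by field_simp
  have h2 : Real.log T = s / T * s := by field_simp; rw [hs2]; ring
  have h3 := log_card_experts_le hT
  rw [h1] at hr
  rw [h2] at h3
  have h4 : expertGain (switchingExpert (two_pos.trans_le hT) e) T (fun s => (h s).observe)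
      ≤ hedgeGain (s / T) (switchingExpert (two_pos.trans_le hT)) T (fun s => (h s).observe)
        + 4 * s := by
    refine le_of_mul_le_mul_left ?_ (by positivity : 0 < s / T)
    linarith
  linarith

/-- The bound of the theorem, with the fractions cleared. -/
theorem utility_bound_iff {T : ℕ} (hT : 1 ≤ T) {B : ℝ} (hB : 0 < B) (C U S L : ℝ) :
    U ≥ (S - C * ((T : ℝ) ^ (3 / 2 : ℝ) / B * √L)) / ((T : ℝ) / B)
      ↔ B / T * S ≤ U + C * √(T * L) := by
  have hT' : (0 : ℝ) < T := by exact_mod_cast hT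
  have h32 : (T : ℝ) ^ (3 / 2 : ℝ) = T * √T := by
    rw [Real.sqrt_eq_rpow, ← Real.rpow_one_add' hT'.le (by norm_num)]
    norm_num
  have : (S - C * ((T : ℝ) ^ (3 / 2 : ℝ) / B * √L)) / ((T : ℝ) / B)
      = B / T * S - C * √(T * L) := by
    rw [h32, Real.sqrt_mul hT'.le]
    field_simp
  rw [this, ge_iff_le, sub_le_iff_le_add]

/-- Off the two tail events the losses are s for the surplus, s + 1 for the budget and at most 4s +
2 for the regret. Their sum 6s + 3 is at most 9s, because T ≥ 2 and L ≥ log 2 ≥ 1/2 force s ≥ 1. -/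
theorem exists_algorithm_of_two_le {T : ℕ} (hT : 2 ≤ T) {B : ℝ} (hB : 0 < B) (hBT : B ≤ T) :
    ∃ alg : Algorithm, ∀ adv : Adversary, ∀ δ : ℝ, 0 < δ → δ < 1 →
      gameLaw alg adv T {h | ¬ B / T * ⨆ l, fixedUtility B h l
        ≤ utility B T h + 9 * √(T * Real.log (T / δ))} ≤ ENNReal.ofReal δ := by
  have hT2 : (2 : ℝ) ≤ T := by exact_mod_cast hT
  have hT0 : 0 < T := two_pos.trans_le hT
  have : Nonempty (Fin T) := ⟨⟨0, hT0⟩⟩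
  obtain ⟨η, hη⟩ := exists_rate hT
  have hρ0 : 0 ≤ B / T := by positivity
  have hρ1 : B / T ≤ 1 := (div_le_one (by positivity)).2 hBT
  refine ⟨hedgeAlgorithm η (switchingExpert hT0) hρ0 hρ1, fun adv δ hδ0 hδ1 => ?_⟩
  set L := Real.log (T / δ) with hLdef
  have hTL : Real.log T ≤ L := Real.log_le_log (by positivity)
    (le_div_self (by positivity) hδ0 hδ1.le)
  have hL : 1 / 2 ≤ L := by
    have := Real.log_le_log two_pos hT2
    linarith [Real.log_two_gt_d9]
  set s := √(T * L) with hs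
  have hs1 : 1 ≤ s := Real.one_le_sqrt.2 (by nlinarith)
  have hsT : √(T * Real.log T) ≤ s := Real.sqrt_le_sqrt (by gcongr)
  have hexp : Real.exp (-L) = δ / T := by
    rw [Real.exp_neg, hLdef, Real.exp_log (by positivity), inv_div]
  have tail1 := hedge_playedSurplus_tail η (switchingExpert hT0) hρ0 hρ1 adv hT0
    (by linarith : 0 ≤ L)
  have tail2 := hedge_activity_tail η (switchingExpert hT0) hρ0 hρ1 adv hT0
    (by linarith : 0 ≤ L)
  refine (measure_mono fun h hh => ?_).trans
    ((measure_union_le _ _).trans ((add_le_add tail1 tail2).trans ?_))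
  · by_contra hnot
    simp only [Set.mem_union, Set.mem_ofPred_eq, not_or, not_le] at hnot hh
    obtain ⟨h1, h2⟩ := hnot
    rw [mul_div_cancel₀ _ (by positivity)] at h2
    have hU := playedSurplus_sub_le_utility hB.le T h
    have hmax : max 0 (activity T h - B + 1) ≤ s + 1 := max_le (by linarith) (by linarith)
    have hsup : ⨆ l, fixedUtility B h l ≤ hedgeGain η (switchingExpert hT0) T
        (fun s => (h s).observe) + (4 * s + 2) :=
      ciSup_le fun l => (hη B h l hB.le).trans (by linarith)
    have h3 := mul_le_mul_of_nonneg_left hsup hρ0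
    have h4 : B / T * (4 * s + 2) ≤ 4 * s + 2 := mul_le_of_le_one_left (by linarith) hρ1
    rw [mul_add] at h3
    linarith
  -- Each tail has probability at most δ/T, and 2δ/T ≤ δ.
  · rw [hexp, ← ENNReal.ofReal_add (by positivity) (by positivity)]
    refine ENNReal.ofReal_le_ofReal ?_
    rw [← add_div, div_le_iff₀ (by positivity)]
    nlinarith

/-! ### A single round -/

/-- The player draws her multiplier uniformly. -/
noncomputable def uniformAlgorithm : Algorithm where
  next _ := Kernel.const _ volume
  markov _ := inferInstance

/-- A uniform multiplier hits any interval of bids below the value with at least its length. -/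
theorem volume_compl_window_le (v : I) {d ε : ℝ} (hd : 0 ≤ d) (hε : 0 ≤ ε) (hv : d + ε < v) :
    (volume {l : I | ¬ (d < l * v ∧ (l : ℝ) * v ≤ d + ε)}) ≤ ENNReal.ofReal (1 - ε) := by
  have hv0 : (0 : ℝ) < v := by linarith
  have hv1 := v.2.2
  have hmeas : MeasurableSet {l : I | d < l * v ∧ (l : ℝ) * v ≤ d + ε} :=
    (measurableSet_lt (by fun_prop) (by fun_prop) : MeasurableSet {l : I | d < l * v}).inter
      (measurableSet_le (by fun_prop) (by fun_prop) : MeasurableSet {l : I | (l : ℝ) * v ≤ d + ε})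
  have hvol : ENNReal.ofReal ε ≤ volume {l : I | d < l * v ∧ (l : ℝ) * v ≤ d + ε} := by
    rw [unitInterval.volume_apply]
    calc ENNReal.ofReal ε ≤ volume (Set.Ioc (d / v) ((d + ε) / v)) := by
          rw [Real.volume_Ioc]
          refine ENNReal.ofReal_le_ofReal ?_
          rw [← sub_div, add_sub_cancel_left]
          exact le_div_self hε hv0 hv1
      _ ≤ _ := by
          refine measure_mono fun x hx => ?_
          rw [Set.mem_Ioc, div_lt_iff₀ hv0, le_div_iff₀ hv0] at hx
          refine ⟨⟨x, ?_, ?_⟩, hx, rfl⟩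
          · exact (pos_of_mul_pos_left (hd.trans_lt hx.1) hv0.le).le
          · exact le_of_mul_le_mul_right (by linarith) hv0
  have : {l : I | ¬ (d < l * v ∧ (l : ℝ) * v ≤ d + ε)}
    = {l : I | d < l * v ∧ (l : ℝ) * v ≤ d + ε}ᶜ := rfl
  rw [this, prob_compl_eq_one_sub hmeas, ENNReal.ofReal_sub _ hε, ENNReal.ofReal_one]
  gcongr

theorem fixedUtility_one (B : ℝ) (h : Fin 1 → Round) (l : I) :
    fixedUtility B h l = open Classical in
      if Round.Wins B (l, (h 0).2) then
        ((h 0).2.1 : ℝ) - min (l * (h 0).2.1 : ℝ) B else 0 :=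
  zero_add _

theorem utility_one (B : ℝ) (h : Fin 1 → Round) : utility B 1 h = fixedUtility B h (h 0).1 := by
  unfold fixedUtility
  congr
  ext i : 1
  rw [Subsingleton.elim i 0]

/-- In a single round, a bid at most `ε` above the competing one is good enough. -/
theorem fixedUtility_one_le {B ε : ℝ} (hB1 : B ≤ 1) (hε : 0 ≤ ε) (h : Fin 1 → Round)
    (hgood : ((h 0).2.1 : ℝ) ≤ (h 0).2.2.1 + ε ∨
      ((h 0).2.2.1 : ℝ) < (h 0).1 * (h 0).2.1 ∧ ((h 0).1 * (h 0).2.1 : ℝ) ≤ (h 0).2.2.1 + ε)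
    (l : I) : B * fixedUtility B h l ≤ utility B 1 h + ε := by
  classical
  rw [utility_one, fixedUtility_one, fixedUtility_one]
  set v := (h 0).2.1
  set d := (h 0).2.2.1
  have hsub : ∀ k : I, (0 : ℝ) ≤ v - min (k * v : ℝ) B := fun k =>
    sub_nonneg.2 ((min_le_left _ _).trans (mul_le_of_le_one_left v.2.1 k.2.2))
  have hU : (0 : ℝ) ≤ if Round.Wins B ((h 0).1, (h 0).2) then
      (v : ℝ) - min ((h 0).1 * v : ℝ) B else 0 := by
    split_ifs
    exacts [hsub _, le_rfl]
  by_cases hl : Round.Wins B (l, (h 0).2)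
  swap
  · rw [if_neg hl, mul_zero]
    exact add_nonneg hU hε
  rw [if_pos hl]
  have hd : (d : ℝ) ≤ min (l * v : ℝ) B := by
    rcases hl with hl | hl
    exacts [hl.le, hl.1.le]
  refine (mul_le_of_le_one_left (hsub l) hB1).trans ?_
  rcases hgood with hgood | ⟨hlt, hle⟩
  · linarith
  -- If d < B, even a capped bid of the player wins. If d = B, then `l` won by a tie, so ties favour
  -- the player, whose bid is also capped at B.
  rcases (hd.trans (min_le_right _ _)).lt_or_eq with hdB | hdB
  · have hw : Round.Wins B ((h 0).1, (h 0).2) := Or.inl (lt_min hlt hdB)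
    rw [if_pos hw]
    linarith [min_le_left ((h 0).1 * v : ℝ) B]
  · have htie : (h 0).2.2.2 = true := by
      rcases hl with hl | hl
      · exact absurd (hl.trans_le (min_le_right _ _)) hdB.not_lt
      · exact hl.2
    have hmin : min ((h 0).1 * v : ℝ) B = B := min_eq_right (hdB ▸ hlt.le)
    have hw : Round.Wins B ((h 0).1, (h 0).2) := Or.inr ⟨hdB.trans hmin.symm, htie⟩
    rw [if_pos hw, hmin]
    linarith

/-- With ε² = log(1/δ), failure requires v > d + ε, hence ε ≤ 1, and has probability at most 1 - ε ≤
1 - ε² ≤ exp(-ε²) = δ. -/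
theorem exists_algorithm_one {B : ℝ} (hB0 : 0 < B) (hB1 : B ≤ 1) :
    ∃ alg : Algorithm, ∀ adv : Adversary, ∀ δ : ℝ, 0 < δ → δ < 1 →
      gameLaw alg adv 1 {h | ¬ B * ⨆ l, fixedUtility B h l
        ≤ utility B 1 h + √(Real.log (1 / δ))} ≤ ENNReal.ofReal δ := by
  refine ⟨uniformAlgorithm, fun adv δ hδ0 hδ1 => ?_⟩
  have hlog : 0 ≤ Real.log (1 / δ) := Real.log_nonneg (one_le_one_div hδ0 hδ1.le)
  set ε := √(Real.log (1 / δ)) with hε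
  have hε0 : 0 ≤ ε := Real.sqrt_nonneg _
  have hε2 : ε ^ 2 = Real.log (1 / δ) := Real.sq_sqrt hlog
  set bad : Set Round := {r | (r.2.2.1 : ℝ) + ε < r.2.1} ∩
    ({r | (r.2.2.1 : ℝ) < r.1 * r.2.1} ∩ {r | (r.1 * r.2.1 : ℝ) ≤ r.2.2.1 + ε})ᶜ
  have hmeas : MeasurableSet bad :=
    (measurableSet_lt (by fun_prop) (by fun_prop)).inter
      ((measurableSet_lt (by fun_prop) (by fun_prop)).inter
        (measurableSet_le (by fun_prop) (by fun_prop))).compl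
  have hmeas' : MeasurableSet {h : Fin 1 → Round | h 0 ∈ bad} := measurable_pi_apply 0 hmeas
  calc gameLaw uniformAlgorithm adv 1 {h | ¬ B * ⨆ l, fixedUtility B h l ≤ utility B 1 h + ε}
      ≤ gameLaw uniformAlgorithm adv 1 {h | h 0 ∈ bad} := by
        refine measure_mono fun h hh => ?_
        by_contra hnot
        refine hh ?_
        have hgood : ((h 0).2.1 : ℝ) ≤ (h 0).2.2.1 + ε ∨ ((h 0).2.2.1 : ℝ) < (h 0).1 * (h 0).2.1 ∧
            ((h 0).1 * (h 0).2.1 : ℝ) ≤ (h 0).2.2.1 + ε := by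
          by_contra hg
          rw [not_or, not_le] at hg
          exact hnot hg
        rw [Real.mul_iSup_of_nonneg hB0.le]
        exact ciSup_le (fixedUtility_one_le hB1 hε0 h hgood)
    _ = ∫⁻ h, {h : Fin 1 → Round | h 0 ∈ bad}.indicator 1 h ∂gameLaw uniformAlgorithm adv 1 :=
        (lintegral_indicator_one hmeas').symm
    _ ≤ ∫⁻ _, ENNReal.ofReal δ ∂gameLaw uniformAlgorithm adv 0 := by
        refine lintegral_gameLaw_succ_le uniformAlgorithm adv 0
          (measurable_one.indicator hmeas') fun h m => ?_
        have hslice : MeasurableSet {l : I | ((l, m) : Round) ∈ bad} :=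
          measurable_prodMk_right hmeas
        refine ((lintegral_indicator_one hslice).trans_le ?_ :)
        change volume {l : I | ((l, m) : Round) ∈ bad} ≤ _
        by_cases hm : (m.2.1 : ℝ) + ε < m.1
        · refine (measure_mono fun l hl => hl.2).trans
            ((volume_compl_window_le m.1 m.2.1.2 hε0 hm).trans (ENNReal.ofReal_le_ofReal ?_))
          have hε1 : ε ≤ 1 := by linarith [m.1.2.2, m.2.1.2]
          have := Real.add_one_le_exp (-ε ^ 2)
          have hδ : Real.exp (-ε ^ 2) = δ := by
            rw [hε2, one_div, Real.log_inv, neg_neg, Real.exp_log hδ0]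
          nlinarith
        · have : {l : I | ((l, m) : Round) ∈ bad} = ∅ :=
            Set.eq_empty_of_forall_notMem fun l hl => hm hl.1
          simp [this]
    _ = ENNReal.ofReal δ := by simp

end FirstPrice

/-- The bound holds with probability at least `1 - δ`: the (outer) probability of the event that it
fails is at most `δ`. -/
theorem mainTheorem1 :
    ∃ C : ℝ, 0 < C ∧
      ∀ (T : ℕ) (B : ℝ), 1 ≤ T → 0 < B → B ≤ T →
        ∃ alg : FirstPrice.Algorithm,
          ∀ adv : FirstPrice.Adversary, ∀ δ : ℝ, 0 < δ →
            FirstPrice.gameLaw alg adv T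
              {h | ¬ (FirstPrice.utility B T h ≥
                ((⨆ l : I, FirstPrice.fixedUtility B h l)
                  - C * ((T : ℝ) ^ (3 / 2 : ℝ) / B * Real.sqrt (Real.log (T / δ))))
                / ((T : ℝ) / B))} ≤ ENNReal.ofReal δ := by
  -- The constant is dictated by T ≥ 2; for T = 1 the constant 1 suffices.
  refine ⟨9, by norm_num, fun T B hT hB hBT => ?_⟩
  simp only [FirstPrice.utility_bound_iff hT hB]
  suffices H : ∃ alg : FirstPrice.Algorithm, ∀ adv : FirstPrice.Adversary, ∀ δ : ℝ, 0 < δ → δ < 1 →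
      FirstPrice.gameLaw alg adv T {h | ¬ B / T * ⨆ l, FirstPrice.fixedUtility B h l
        ≤ FirstPrice.utility B T h + 9 * √(T * Real.log (T / δ))} ≤ ENNReal.ofReal δ by
    obtain ⟨alg, halg⟩ := H
    refine ⟨alg, fun adv δ hδ => ?_⟩
    rcases lt_or_ge δ 1 with hδ1 | hδ1
    · exact halg adv δ hδ hδ1
    · exact prob_le_one.trans (by simpa using hδ1)
  rcases hT.eq_or_lt with rfl | hT2
  · obtain ⟨alg, halg⟩ := FirstPrice.exists_algorithm_one hB (by simpa using hBT)
    refine ⟨alg, fun adv δ hδ hδ1 => (measure_mono fun h hh => ?_).trans (halg adv δ hδ hδ1)⟩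
    refine fun hle => hh ?_
    simp only [Nat.cast_one, div_one, one_mul] at hle ⊢
    linarith [Real.sqrt_nonneg (Real.log (1 / δ))]
  · exact FirstPrice.exists_algorithm_of_two_le hT2 hB hBT
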